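/- Let $d\in\{2,3\}$. There is an exponent $\alpha\in(0,1)$, depending only on $d$, such that the following holds. Let $D\subset\mathbb{R}^d$ be a bounded domain (open and connected), and let $n\in C^1(D)$ be real-valued and bounded. Let $z_1,\dots,z_M\in D$, and let $c_0>0$ be such that $|z_i-z_j|\ge c_0$ for $i\neq j$ and $\operatorname{dist}(z_m,\partial D)\ge c_0$ for all $m$. Let $B_1,\dots,B_M\subset\mathbb{R}^d$ be bounded open sets (for example smooth deformations of a ball centered at the origin), and let $n_1,\dots,n_M$ be real constants. For $\varepsilon>0$ such that the defects $z_m+\varepsilon B_m$ are pairwise disjoint, let $n_\varepsilon=n_m$ on $z_m+\varepsilon B_m$ for $m=1,\dots,M$ and $n_\varepsilon=n$ off the defects; let $n_0=n$. Let $X(D)=\{(w,v): w,v\in H^1(D),\ w-v\in H^1_0(D)\}$ (complex-valued functions), with the inner product of $H^1(D)\times H^1(D)$, where $H^1_0(D)$ is the closure of $C_c^\infty(D)$ in $H^1(D)$. Let $\mathbf{B}_\varepsilon:X(D)\to X(D)$ be the bounded linear operator given by the Riesz representation theorem through $$\big(\mathbf{B}_\varepsilon(w,v);(\varphi_1,\varphi_2)\big)_{X(D)}=\int_D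 n_\varepsilon w\,\overline{\varphi}_1-v\,\overline{\varphi}_2\,dx\qquad\text{for all }(w,v),(\varphi_1,\varphi_2)\in X(D).$$ Then for all sufficiently small $\varepsilon>0$ the defects are pairwise disjoint and contained in $D$; the operators $\mathbf{B}_0$ and $\mathbf{B}_\varepsilon$ (for every $\varepsilon>0$ with pairwise disjoint defects) exist; $\mathbf{B}_\varepsilon\to\mathbf{B}_0$ in the operator norm as $\varepsilon\to0^+$; and there is a constant $C$ independent of $\varepsilon$ such that $$\|\mathbf{B}_\varepsilon-\mathbf{B}_0\|\le C\,\varepsilon^{\alpha}$$ for every $\varepsilon>0$ for which the defects are pairwise disjoint. -/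

import Mathlib

open Filter Topology MeasureTheory
open scoped ContDiff ComplexConjugate

noncomputable section

namespace Transmission

/-- Euclidean space of dimension `d`. -/
abbrev E (d : ℕ) : Type := EuclideanSpace ℝ (Fin d)

/-- Lebesgue measure on `D`. -/
abbrev vol {d : ℕ} (D : Set (E d)) : Measure (E d) := (volume : Measure (E d)).restrict D

/-- `φ` belongs to `C_c^∞(D; F)`. -/
structure IsTest {d : ℕ} {F : Type*} [NormedAddCommGroup F] [NormedSpace ℝ F]
    (D : Set (E d)) (φ : E d → F) : Prop where
  smooth : ContDiff ℝ ∞ φ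
  compact : HasCompactSupport φ
  support : tsupport φ ⊆ D

/-- The partial derivative `∂φ/∂x_i` of a real function. -/
def partialDeriv {d : ℕ} (i : Fin d) (φ : E d → ℝ) (x : E d) : ℝ :=
  fderiv ℝ φ x (EuclideanSpace.single i 1)

/-- `g` is the weak gradient of `u` on `D`. -/
def IsWeakGradient {d : ℕ} (D : Set (E d)) (u : E d → ℂ)
    (g : E d → EuclideanSpace ℂ (Fin d)) : Prop :=
  ∀ φ : E d → ℝ, IsTest D φ → ∀ i : Fin d,
    ∫ x in D, u x * (partialDeriv i φ x : ℂ) = - ∫ x in D, g x i * (φ x : ℂ)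

/-- `L²(D) × L²(D)^d` with the Hilbert space structure of the product. -/
abbrev L2Pair {d : ℕ} (D : Set (E d)) : Type :=
  WithLp 2 (Lp ℂ 2 (vol D) × Lp (EuclideanSpace ℂ (Fin d)) 2 (vol D))

theorem IsTest.memLp {d : ℕ} {D : Set (E d)} {φ : E d → ℝ} (h : IsTest D φ) :
    MemLp (fun x => (φ x : ℂ)) 2 (vol D) := by
  have h1 : Continuous (fun x => (φ x : ℂ)) :=
    Complex.continuous_ofReal.comp h.smooth.continuous
  have h2 : HasCompactSupport (fun x => (φ x : ℂ)) :=
    h.compact.comp_left (g := fun t : ℝ => (t : ℂ)) (by simp)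
  exact (h1.memLp_of_hasCompactSupport (μ := volume) h2).restrict D

theorem IsTest.memLp_partialDeriv {d : ℕ} {D : Set (E d)} {φ : E d → ℝ} (h : IsTest D φ)
    (i : Fin d) : MemLp (fun x => (partialDeriv i φ x : ℂ)) 2 (vol D) := by
  have h0 : Continuous (partialDeriv i φ) :=
    (h.smooth.continuous_fderiv (by simp)).clm_apply continuous_const
  have h1 : Continuous (fun x => (partialDeriv i φ x : ℂ)) :=
    Complex.continuous_ofReal.comp h0
  have h2 : HasCompactSupport (fun x => (partialDeriv i φ x : ℂ)) :=
    (h.compact.fderiv (𝕜 := ℝ)).comp_left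
      (g := fun L : E d →L[ℝ] ℝ => ((L (EuclideanSpace.single i 1) : ℝ) : ℂ)) (by simp)
  exact (h1.memLp_of_hasCompactSupport (μ := volume) h2).restrict D

theorem memLp_coord {d : ℕ} {D : Set (E d)} (g : Lp (EuclideanSpace ℂ (Fin d)) 2 (vol D))
    (i : Fin d) : MemLp (fun x => g x i) 2 (vol D) :=
  (EuclideanSpace.proj (𝕜 := ℂ) i).comp_memLp' (Lp.memLp g)

/-- The Sobolev space `H¹(D)` of complex-valued functions, as the space of pairs `(u, ∇u)` in
`L²(D) × L²(D)^d`; the inherited inner product is `∫_D u ū' + ∇u · conj ∇u'`. -/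
def H1 {d : ℕ} (D : Set (E d)) : Submodule ℂ (L2Pair D) where
  carrier := {p | IsWeakGradient D p.fst p.snd}
  zero_mem' := by
    intro φ _ i
    have h1 : ∫ x in D, (((0 : L2Pair D).fst : E d → ℂ) x) * (partialDeriv i φ x : ℂ) = 0 := by
      rw [← integral_zero (E d) ℂ (μ := vol D)]
      refine integral_congr_ae ?_
      filter_upwards [Lp.coeFn_zero ℂ 2 (vol D)] with x hx
      simp only [WithLp.zero_fst, hx, Pi.zero_apply, zero_mul]
    have h2 : ∫ x in D, (((0 : L2Pair D).snd : E d → EuclideanSpace ℂ (Fin d)) x i) * (φ x : ℂ)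
        = 0 := by
      rw [← integral_zero (E d) ℂ (μ := vol D)]
      refine integral_congr_ae ?_
      filter_upwards [Lp.coeFn_zero (EuclideanSpace ℂ (Fin d)) 2 (vol D)] with x hx
      simp only [WithLp.zero_snd, hx, Pi.zero_apply, PiLp.zero_apply, zero_mul]
    rw [h1, h2, neg_zero]
  add_mem' := by
    intro p q hp hq φ hφ i
    have i1 := fun r : L2Pair D =>
      MemLp.integrable_mul (Lp.memLp r.fst) (hφ.memLp_partialDeriv i)
    have i2 := fun r : L2Pair D => MemLp.integrable_mul (memLp_coord r.snd i) hφ.memLp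
    have h1 : ∫ x in D, ((p + q).fst : E d → ℂ) x * (partialDeriv i φ x : ℂ)
        = (∫ x in D, p.fst x * (partialDeriv i φ x : ℂ))
          + ∫ x in D, q.fst x * (partialDeriv i φ x : ℂ) := by
      refine Eq.trans ?_ (integral_add (i1 p) (i1 q))
      refine integral_congr_ae ?_
      filter_upwards [Lp.coeFn_add p.fst q.fst] with x hx
      simp only [WithLp.add_fst, hx, Pi.add_apply, add_mul]
    have h2 : ∫ x in D, ((p + q).snd : E d → EuclideanSpace ℂ (Fin d)) x i * (φ x : ℂ)
        = (∫ x in D, p.snd x i * (φ x : ℂ)) + ∫ x in D, q.snd x i * (φ x : ℂ) := by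
      refine Eq.trans ?_ (integral_add (i2 p) (i2 q))
      refine integral_congr_ae ?_
      filter_upwards [Lp.coeFn_add p.snd q.snd] with x hx
      simp only [WithLp.add_snd, hx, Pi.add_apply, PiLp.add_apply, add_mul]
    rw [h1, h2, hp φ hφ i, hq φ hφ i, neg_add]
  smul_mem' := by
    intro c p hp φ hφ i
    have h1 : ∫ x in D, ((c • p).fst : E d → ℂ) x * (partialDeriv i φ x : ℂ)
        = c * ∫ x in D, p.fst x * (partialDeriv i φ x : ℂ) := by
      rw [← integral_const_mul]
      refine integral_congr_ae ?_
      filter_upwards [Lp.coeFn_smul c p.fst] with x hx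
      simp only [WithLp.smul_fst, hx, Pi.smul_apply, smul_eq_mul, mul_assoc]
    have h2 : ∫ x in D, ((c • p).snd : E d → EuclideanSpace ℂ (Fin d)) x i * (φ x : ℂ)
        = c * ∫ x in D, p.snd x i * (φ x : ℂ) := by
      rw [← integral_const_mul]
      refine integral_congr_ae ?_
      filter_upwards [Lp.coeFn_smul c p.snd] with x hx
      simp only [WithLp.smul_snd, hx, Pi.smul_apply, PiLp.smul_apply, smul_eq_mul, mul_assoc]
    rw [h1, h2, hp φ hφ i, mul_neg]

/-- `H¹₀(D)`: the closure of `C_c^∞(D)` in the norm of `H¹(D)`, which is the norm of the pair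
`(u, ∇u)`. (The set inside the span is already a subspace of `H¹(D)`.) -/
def H10 {d : ℕ} (D : Set (E d)) : Submodule ℂ (L2Pair D) :=
  (Submodule.span ℂ
    {p : L2Pair D | p ∈ H1 D ∧ ∃ φ : E d → ℂ, IsTest D φ ∧ p.fst =ᵐ[vol D] φ}).topologicalClosure

/-- `X(D)`: the pairs `(w, v)` with `w` and `v` in `H¹(D)` and `w - v` in `H¹₀(D)`, equipped with
the inner product of `H¹(D) × H¹(D)`. -/
def X {d : ℕ} (D : Set (E d)) : Submodule ℂ (WithLp 2 (L2Pair D × L2Pair D)) where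
  carrier := {p | p.fst ∈ H1 D ∧ p.snd ∈ H1 D ∧ p.fst - p.snd ∈ H10 D}
  zero_mem' := by
    refine ⟨(H1 D).zero_mem, (H1 D).zero_mem, ?_⟩
    simp
  add_mem' := by
    rintro p q ⟨hp1, hp2, hp3⟩ ⟨hq1, hq2, hq3⟩
    refine ⟨(H1 D).add_mem hp1 hq1, (H1 D).add_mem hp2 hq2, ?_⟩
    rw [WithLp.add_fst, WithLp.add_snd, add_sub_add_comm]
    exact (H10 D).add_mem hp3 hq3
  smul_mem' := by
    rintro c p ⟨hp1, hp2, hp3⟩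
    refine ⟨(H1 D).smul_mem c hp1, (H1 D).smul_mem c hp2, ?_⟩
    rw [WithLp.smul_fst, WithLp.smul_snd, ← smul_sub]
    exact (H10 D).smul_mem c hp3

/-- The function `w` of an element `(w, v)` of `X(D)`. -/
def X.w {d : ℕ} {D : Set (E d)} (p : X D) : E d → ℂ :=
  (p : WithLp 2 (L2Pair D × L2Pair D)).fst.fst

/-- The function `v` of an element `(w, v)` of `X(D)`. -/
def X.v {d : ℕ} {D : Set (E d)} (p : X D) : E d → ℂ :=
  (p : WithLp 2 (L2Pair D × L2Pair D)).snd.fst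

/-- The sesquilinear form `∫_D q w conj(φ₁) - v conj(φ₂) dx` at `((w, v), (φ₁, φ₂))`. -/
def formB {d : ℕ} (D : Set (E d)) (q : E d → ℝ) (p φ : X D) : ℂ :=
  ∫ x in D, ((q x : ℂ) * X.w p x * conj (X.w φ x) - X.v p x * conj (X.v φ x))

/-- `B` is the bounded operator on `X(D)` that represents the form with coefficient `q` in the
sense of Riesz, `(B (w, v) ; (φ₁, φ₂))_{X(D)} = ∫_D q w conj(φ₁) - v conj(φ₂) dx`.
Mathlib's inner product is antilinear in its first argument. -/
def IsOperatorOf {d : ℕ} (D : Set (E d)) (q : E d → ℝ) (B : X D →L[ℂ] X D) : Prop :=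
  ∀ p φ : X D, inner ℂ φ (B p) = formB D q p φ

/-- The operator of a form is unique. -/
theorem IsOperatorOf.unique {d : ℕ} {D : Set (E d)} {q : E d → ℝ} {B B' : X D →L[ℂ] X D}
    (h : IsOperatorOf D q B) (h' : IsOperatorOf D q B') : B = B' := by
  ext1 p
  exact ext_inner_left ℂ fun φ => (h p φ).trans (h' p φ).symm

/-- The defect `z_m + ε B_m`. -/
def defect {d M : ℕ} (z : Fin M → E d) (S : Fin M → Set (E d)) (ε : ℝ) (m : Fin M) :
    Set (E d) :=
  (fun y => z m + ε • y) '' S m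

/-- `ε > 0`, and the defects `z_m + ε B_m` are pairwise disjoint, so that the perturbed
coefficient is well defined. -/
def Admissible {d M : ℕ} (z : Fin M → E d) (S : Fin M → Set (E d)) (ε : ℝ) : Prop :=
  0 < ε ∧ Pairwise fun i j => Disjoint (defect z S ε i) (defect z S ε j)

open Classical in
/-- The perturbed coefficient `n_ε`: it is `n_m` on `z_m + ε B_m` and `n` off the defects.
It is only used for pairwise disjoint defects, where the index `m` is unique. -/
def perturbed {d M : ℕ} (n : E d → ℝ) (z : Fin M → E d) (S : Fin M → Set (E d))
    (nm : Fin M → ℝ) (ε : ℝ) (x : E d) : ℝ :=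
  if h : ∃ m, x ∈ defect z S ε m then nm h.choose else n x

end Transmission

end

namespace Transmission

/-! The operators have the form `B = w† T w - v† v`, where `w` and `v` also denote the embeddings
`(w, v) ↦ w` and `(w, v) ↦ v` into `L²(D)` and `T` is multiplication by the coefficient. Hence `B_ε
- B_0 = w† (T_ε - T_0) w`, and since `‖w†‖ ≤ 1` it suffices to bound `(n_ε - n) w` in `L²(D)` by the
norm of `(w, v)`. The factor `n_ε - n` is bounded and lives on the balls of radius `ε R` about the
`z_m`, so everything rests on one estimate: `‖u‖_{L²(B(z, r))} ≤ C √r ‖u‖_{H¹(D)}`, which gives the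
exponent `1/2`.

Heuristically, a function with one square-integrable derivative in the direction `eᵢ` is bounded
along almost every line in that direction, and such a line meets the ball in length at most `2r`.
This is proved by duality, directly from the weak gradient. A test function `g` supported in a small
ball is split as `g = ∂ᵢH + c⁻¹ A`, with `H` and `A` averages of `g` over segments of length `c`
(`partialDeriv_segmentAverage`). Both have `L²` norm at most `√(2ρc) ‖g‖`
(`eLpNorm_segmentAverage_le`). Integrating `u g` and moving `∂ᵢ` onto `u` gives the factor `√ρ`
(`norm_integral_mul_test_le`), and letting `g` approach the conjugate of `u` on the ball gives the
estimate (`eLpNorm_ball_le`). -/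

/-! ### Averages over segments in a coordinate direction -/

/-- The average `∫₀ᶜ η(s) g(x - s eᵢ) ds` of `g` over a segment in the direction `eᵢ`. -/
noncomputable def segmentAverage {d : ℕ} (i : Fin d) (c : ℝ) (η : ℝ → ℝ) (g : E d → ℝ)
    (x : E d) : ℝ :=
  ∫ s in (0 : ℝ)..c, η s * g (x - s • EuclideanSpace.single i (1 : ℝ))

/-- The finite measure carried by the segment is convolved with `g`; on the segment the coordinate
`y i` recovers the parameter `s`, hence the weight `η (y i)`. Smoothness of the average then follows
from that of convolutions. -/
theorem segmentAverage_eq_convolution {d : ℕ} (i : Fin d) {c : ℝ} (hc : 0 < c) {η : ℝ → ℝ}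
    (hη : Continuous η) {g : E d → ℝ} (hg : Continuous g) :
    segmentAverage i c η g = MeasureTheory.convolution (fun y : E d => η (y i)) g
      (ContinuousLinearMap.mul ℝ ℝ)
      (((volume : Measure ℝ).restrict (Set.Ioc 0 c)).map
        fun s => s • (EuclideanSpace.single i (1 : ℝ) : E d)) := by
  funext x
  rw [convolution_def, integral_map (by fun_prop)]
  · rw [segmentAverage, intervalIntegral.integral_of_le hc.le]
    simp
  · apply Continuous.aestronglyMeasurable
    simp only [ContinuousLinearMap.mul_apply']
    fun_prop

theorem contDiff_segmentAverage {d : ℕ} (i : Fin d) {c : ℝ} (hc : 0 < c) {η : ℝ → ℝ}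
    (hη : Continuous η) {g : E d → ℝ} (hg : ContDiff ℝ ∞ g) (hg' : HasCompactSupport g) :
    ContDiff ℝ ∞ (segmentAverage i c η g) := by
  rw [segmentAverage_eq_convolution i hc hη hg.continuous]
  have : IsFiniteMeasure (((volume : Measure ℝ).restrict (Set.Ioc 0 c)).map
        fun s => s • (EuclideanSpace.single i (1 : ℝ) : E d)) := inferInstance
  refine hg'.contDiff_convolution_right _ (Continuous.locallyIntegrable (by fun_prop)) hg

theorem hasDerivAt_segment {d : ℕ} (i : Fin d) {g : E d → ℝ} (hg : ContDiff ℝ ∞ g) (x : E d)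
    (s : ℝ) : HasDerivAt (fun s : ℝ => g (x - s • EuclideanSpace.single i (1 : ℝ)))
      (- partialDeriv i g (x - s • EuclideanSpace.single i (1 : ℝ))) s := by
  have h1 : HasFDerivAt g (fderiv ℝ g (x - s • EuclideanSpace.single i (1 : ℝ)))
      (x - s • EuclideanSpace.single i (1 : ℝ)) :=
    (hg.differentiable (by simp) _).hasFDerivAt
  have h2 : HasDerivAt (fun s : ℝ => x - s • (EuclideanSpace.single i (1 : ℝ) : E d))
      (- EuclideanSpace.single i (1 : ℝ)) s := by
    simpa using ((hasDerivAt_id s).smul_const (EuclideanSpace.single i (1 : ℝ) : E d)).const_sub x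
  have h3 := h1.comp_hasDerivAt s h2
  rw [map_neg] at h3
  exact h3

theorem hasFDerivAt_segmentAverage {d : ℕ} (i : Fin d) {c : ℝ} {η : ℝ → ℝ}
    (hη : Continuous η) {g : E d → ℝ} (hg : ContDiff ℝ ∞ g) (hg' : HasCompactSupport g)
    (x : E d) :
    HasFDerivAt (segmentAverage i c η g)
      (∫ s in (0 : ℝ)..c, η s • fderiv ℝ g (x - s • EuclideanSpace.single i (1 : ℝ))) x := by
  have hf : Continuous (fderiv ℝ g) := hg.continuous_fderiv (by simp)
  have hgc := hg.continuous
  obtain ⟨C, hC⟩ := (hg'.fderiv (𝕜 := ℝ)).exists_bound_of_continuous hf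
  refine intervalIntegral.hasFDerivAt_integral_of_dominated_of_fderiv_le
    (F' := fun y s => η s • fderiv ℝ g (y - s • EuclideanSpace.single i (1 : ℝ)))
    (bound := fun s => |η s| * C) univ_mem
    (.of_forall fun y => Continuous.aestronglyMeasurable (by fun_prop))
    (Continuous.intervalIntegrable (by fun_prop) _ _)
    (Continuous.aestronglyMeasurable (by fun_prop))
    (.of_forall fun s _ y _ => ?_) (Continuous.intervalIntegrable (by fun_prop) _ _)
    (.of_forall fun s _ y _ => ?_)
  · rw [norm_smul, Real.norm_eq_abs]
    exact mul_le_mul_of_nonneg_left (hC _) (abs_nonneg _)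
  · have h1 : HasFDerivAt g (fderiv ℝ g (y - s • EuclideanSpace.single i (1 : ℝ)))
        (y - s • EuclideanSpace.single i (1 : ℝ)) :=
      (hg.differentiable (by simp) _).hasFDerivAt
    have h2 := h1.comp y ((hasFDerivAt_id y).sub_const (s • EuclideanSpace.single i (1 : ℝ)))
    exact h2.const_mul (η s)

/-- Along the segment `∂ᵢg` is minus the `s`-derivative, so one integrates by parts in `s`. The
weight `1 - s/c` is `1` at `s = 0` and `0` at `s = c`: the boundary contributes only `g x`, and the
slope `-1/c` produces the unweighted average. -/
theorem partialDeriv_segmentAverage {d : ℕ} (i : Fin d) {c : ℝ} (hc : 0 < c) {g : E d → ℝ}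
    (hg : ContDiff ℝ ∞ g) (hg' : HasCompactSupport g) (x : E d) :
    partialDeriv i (segmentAverage i c (fun s => 1 - s / c) g) x
      = g x - c⁻¹ * segmentAverage i c (fun _ => 1) g x := by
  have hf : Continuous (fderiv ℝ g) := hg.continuous_fderiv (by simp)
  have hp : Continuous (partialDeriv i g) := hf.clm_apply continuous_const
  have hη : Continuous fun s : ℝ => 1 - s / c := by fun_prop
  rw [partialDeriv, (hasFDerivAt_segmentAverage i hη hg hg' x).fderiv,
    ContinuousLinearMap.intervalIntegral_apply (Continuous.intervalIntegrable (by fun_prop) _ _)]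
  have key := intervalIntegral.integral_mul_deriv_eq_deriv_mul (a := 0) (b := c)
    (u := fun s => 1 - s / c) (u' := fun _ => - c⁻¹)
    (v := fun s => g (x - s • EuclideanSpace.single i (1 : ℝ)))
    (v' := fun s => - partialDeriv i g (x - s • EuclideanSpace.single i (1 : ℝ)))
    (fun s _ => by simpa [div_eq_mul_inv] using ((hasDerivAt_id s).mul_const c⁻¹).const_sub 1)
    (fun s _ => hasDerivAt_segment i hg x s)
    (Continuous.intervalIntegrable (by fun_prop) _ _)
    (Continuous.intervalIntegrable (by fun_prop) _ _)
  simp only [mul_neg, intervalIntegral.integral_neg, neg_mul, intervalIntegral.integral_const_mul,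
    div_self hc.ne', sub_self, zero_mul, zero_div, sub_zero, one_mul, zero_smul] at key
  simp only [segmentAverage, one_mul, _root_.smul_apply, smul_eq_mul]
  change ∫ s in (0 : ℝ)..c, (1 - s / c) *
    partialDeriv i g (x - s • EuclideanSpace.single i (1 : ℝ)) = _
  linarith

theorem support_segmentAverage_subset {d : ℕ} (i : Fin d) {c ρ : ℝ} (hc : 0 < c) (η : ℝ → ℝ)
    {g : E d → ℝ} {z : E d} (hg : Function.support g ⊆ Metric.closedBall z ρ) :
    Function.support (segmentAverage i c η g) ⊆ Metric.closedBall z (ρ + c) := by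
  intro x hx
  by_contra hx'
  refine hx ?_
  rw [segmentAverage]
  rw [intervalIntegral.integral_congr (g := fun _ => (0 : ℝ)), intervalIntegral.integral_zero]
  intro s hs
  rw [Set.uIcc_of_le hc.le] at hs
  have : g (x - s • EuclideanSpace.single i (1 : ℝ)) = 0 := by
    by_contra h
    have h1 := hg h
    rw [Metric.mem_closedBall, dist_eq_norm] at h1 hx'
    apply hx'
    calc ‖x - z‖ = ‖(x - s • EuclideanSpace.single i (1 : ℝ) - z)
          + s • EuclideanSpace.single i (1 : ℝ)‖ := by congr 1; abel
      _ ≤ ‖x - s • EuclideanSpace.single i (1 : ℝ) - z‖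
          + ‖s • (EuclideanSpace.single i (1 : ℝ) : E d)‖ := norm_add_le _ _
      _ ≤ ρ + c := by
        refine add_le_add h1 ?_
        rw [norm_smul, PiLp.norm_single, norm_one, mul_one, Real.norm_eq_abs,
          abs_of_nonneg hs.1]
        exact hs.2
  simp [this]

/-- Only those `s` with `x - s eᵢ` in the ball contribute, and they lie in an interval of length
`2ρ`. Cauchy–Schwarz against the indicator of that interval gives the factor `2ρ` in place of the
cruder `c`. -/
theorem enorm_sq_segmentAverage_le {d : ℕ} (i : Fin d) {c ρ : ℝ} (hc : 0 < c)
    {η : ℝ → ℝ} (hη : ∀ s ∈ Set.Ioc 0 c, |η s| ≤ 1) {g : E d → ℝ} (hgc : Continuous g) {z : E d}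
    (hg : Function.support g ⊆ Metric.closedBall z ρ) (x : E d) :
    ‖segmentAverage i c η g x‖ₑ ^ (2 : ℝ) ≤ ENNReal.ofReal (2 * ρ) *
      ∫⁻ s in Set.Ioc 0 c, ‖g (x - s • EuclideanSpace.single i (1 : ℝ))‖ₑ ^ (2 : ℝ) := by
  set e : E d := EuclideanSpace.single i (1 : ℝ)
  set I : Set ℝ := Set.Icc (x i - z i - ρ) (x i - z i + ρ)
  set φ : ℝ → ENNReal := I.indicator fun _ => 1
  have h1 : ‖segmentAverage i c η g x‖ₑ ≤ ∫⁻ s in Set.Ioc 0 c, φ s * ‖g (x - s • e)‖ₑ := by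
    rw [segmentAverage, intervalIntegral.integral_of_le hc.le]
    refine (enorm_integral_le_lintegral_enorm _).trans ?_
    refine setLIntegral_mono' measurableSet_Ioc fun s hs => ?_
    rw [enorm_mul]
    -- Off `I`, the `i`-th coordinate alone already puts `x - s eᵢ` outside the ball.
    by_cases hsI : s ∈ I
    · simp only [φ, Set.indicator_of_mem hsI]
      gcongr
      rw [Real.enorm_eq_ofReal_abs, ← ENNReal.ofReal_one]
      exact ENNReal.ofReal_le_ofReal (hη s hs)
    · have : g (x - s • e) = 0 := by
        by_contra h
        have h1 := hg h
        rw [Metric.mem_closedBall, dist_eq_norm] at h1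
        have h2 := (PiLp.norm_apply_le (x - s • e - z) i).trans h1
        simp only [PiLp.sub_apply, PiLp.smul_apply, e, PiLp.single_apply, if_true,
          smul_eq_mul, mul_one, Real.norm_eq_abs, abs_le] at h2
        exact hsI ⟨by linarith [h2.2], by linarith [h2.1]⟩
      rw [show g (x - s • EuclideanSpace.single i 1) = 0 from this]
      simp
  have hφ : Measurable φ := measurable_const.indicator measurableSet_Icc
  have hG : Measurable fun s : ℝ => ‖g (x - s • e)‖ₑ := by
    have : Continuous fun s : ℝ => g (x - s • e) := by fun_prop
    exact this.measurable.enorm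
  have h2 := ENNReal.lintegral_mul_le_Lp_mul_Lq (volume.restrict (Set.Ioc 0 c))
    Real.HolderConjugate.two_two hφ.aemeasurable hG.aemeasurable
  have h3 : ∫⁻ s in Set.Ioc 0 c, φ s ^ (2 : ℝ) ≤ ENNReal.ofReal (2 * ρ) := by
    calc ∫⁻ s in Set.Ioc 0 c, φ s ^ (2 : ℝ) ≤ ∫⁻ s, φ s ^ (2 : ℝ) := setLIntegral_le_lintegral _ _
      _ = ∫⁻ s, I.indicator (fun _ => 1) s := by
        refine lintegral_congr fun s => ?_
        by_cases hs : s ∈ I <;> simp [φ, hs]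
      _ = volume I := by rw [lintegral_indicator_const measurableSet_Icc, one_mul]
      _ = ENNReal.ofReal (2 * ρ) := by rw [Real.volume_Icc]; congr 1; ring
  calc ‖segmentAverage i c η g x‖ₑ ^ (2 : ℝ)
      ≤ ((∫⁻ s in Set.Ioc 0 c, φ s ^ (2 : ℝ)) ^ (1 / 2 : ℝ) *
        (∫⁻ s in Set.Ioc 0 c, ‖g (x - s • e)‖ₑ ^ (2 : ℝ)) ^ (1 / 2 : ℝ)) ^ (2 : ℝ) :=
        ENNReal.rpow_le_rpow (h1.trans h2) (by norm_num)
    _ = (∫⁻ s in Set.Ioc 0 c, φ s ^ (2 : ℝ)) *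
        ∫⁻ s in Set.Ioc 0 c, ‖g (x - s • e)‖ₑ ^ (2 : ℝ) := by
      rw [ENNReal.mul_rpow_of_nonneg _ _ (by norm_num), ← ENNReal.rpow_mul, ← ENNReal.rpow_mul]
      norm_num
    _ ≤ _ := by gcongr

/-- Integrate the pointwise bound in `x` and exchange the integrals: each translate of `g` has the
same norm, and integration over `s` contributes the factor `c`. -/
theorem eLpNorm_segmentAverage_le {d : ℕ} (i : Fin d) {c ρ : ℝ} (hc : 0 < c)
    {η : ℝ → ℝ} (hη : ∀ s ∈ Set.Ioc 0 c, |η s| ≤ 1) {g : E d → ℝ} (hgc : Continuous g) {z : E d}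
    (hg : Function.support g ⊆ Metric.closedBall z ρ) (hρ : 0 ≤ ρ) :
    eLpNorm (segmentAverage i c η g) 2 volume
      ≤ ENNReal.ofReal (√(2 * ρ * c)) * eLpNorm g 2 volume := by
  have h : ∫⁻ x, ‖segmentAverage i c η g x‖ₑ ^ (2 : ℝ)
      ≤ ENNReal.ofReal (2 * ρ * c) * ∫⁻ x, ‖g x‖ₑ ^ (2 : ℝ) := by
    calc ∫⁻ x, ‖segmentAverage i c η g x‖ₑ ^ (2 : ℝ)
        ≤ ∫⁻ x : E d, ENNReal.ofReal (2 * ρ) * ∫⁻ s in Set.Ioc 0 c,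
            ‖g (x - s • EuclideanSpace.single i (1 : ℝ))‖ₑ ^ (2 : ℝ) :=
          lintegral_mono fun x => enorm_sq_segmentAverage_le i hc hη hgc hg x
      _ = ENNReal.ofReal (2 * ρ) * ∫⁻ x : E d, ∫⁻ s in Set.Ioc 0 c,
            ‖g (x - s • EuclideanSpace.single i (1 : ℝ))‖ₑ ^ (2 : ℝ) :=
          lintegral_const_mul' _ _ ENNReal.ofReal_ne_top
      _ = ENNReal.ofReal (2 * ρ) * ∫⁻ s in Set.Ioc 0 c, ∫⁻ x : E d,
            ‖g (x - s • EuclideanSpace.single i (1 : ℝ))‖ₑ ^ (2 : ℝ) := by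
          rw [lintegral_lintegral_swap]
          have : Continuous fun q : E d × ℝ => g (q.1 - q.2 • EuclideanSpace.single i (1 : ℝ)) := by
            fun_prop
          exact (this.measurable.enorm.pow_const (2 : ℝ)).aemeasurable
      _ = ENNReal.ofReal (2 * ρ) * ∫⁻ s in Set.Ioc 0 c, ∫⁻ x : E d, ‖g x‖ₑ ^ (2 : ℝ) := by
          congr 1
          refine lintegral_congr fun s => ?_
          exact lintegral_sub_right_eq_self (fun x => ‖g x‖ₑ ^ (2 : ℝ)) _
      _ = _ := by
          rw [setLIntegral_const, Real.volume_Ioc, sub_zero, mul_comm (lintegral _ _), ← mul_assoc,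
            ← ENNReal.ofReal_mul (by positivity)]
  rw [eLpNorm_eq_lintegral_rpow_enorm_toReal (by norm_num) (by norm_num),
    eLpNorm_eq_lintegral_rpow_enorm_toReal (by norm_num) (by norm_num), ENNReal.toReal_ofNat]
  refine (ENNReal.rpow_le_rpow h (by norm_num)).trans_eq ?_
  rw [ENNReal.mul_rpow_of_nonneg _ _ (by norm_num), Real.sqrt_eq_rpow,
    ENNReal.ofReal_rpow_of_nonneg (by positivity) (by norm_num)]

/-! ### Pairing `H¹` functions with test functions supported in small balls -/

theorem norm_integral_mul_le_eLpNorm {α : Type*} [MeasurableSpace α] {μ : Measure α}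
    {f g : α → ℂ} (hf : MemLp f 2 μ) (hg : MemLp g 2 μ) :
    ‖∫ x, f x * g x ∂μ‖ ≤ (eLpNorm f 2 μ).toReal * (eLpNorm g 2 μ).toReal := by
  have h1 : ‖∫ x, f x * g x ∂μ‖ₑ ≤ eLpNorm f 2 μ * eLpNorm g 2 μ := by
    refine (enorm_integral_le_lintegral_enorm _).trans ?_
    rw [← eLpNorm_one_eq_lintegral_enorm]
    exact eLpNorm_smul_le_mul_eLpNorm (p := 2) (q := 2) (r := 1) (f := g) (φ := f) hg.1 hf.1
  rw [← ENNReal.toReal_mul, ← toReal_enorm]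
  exact ENNReal.toReal_mono (ENNReal.mul_ne_top hf.2.ne hg.2.ne) h1

theorem eLpNorm_ofReal_restrict_le {d : ℕ} (D : Set (E d)) (f : E d → ℝ) :
    eLpNorm (fun x => (f x : ℂ)) 2 (vol D) ≤ eLpNorm f 2 volume := by
  refine (eLpNorm_mono_measure _ Measure.restrict_le_self).trans_eq ?_
  exact eLpNorm_congr_norm_ae (.of_forall fun x => by simp)

theorem norm_fst_le {α β : Type*} [SeminormedAddCommGroup α] [SeminormedAddCommGroup β]
    (p : WithLp 2 (α × β)) : ‖p.fst‖ ≤ ‖p‖ := by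
  rw [WithLp.prod_norm_eq_of_L2]
  exact Real.le_sqrt_of_sq_le (by nlinarith [sq_nonneg ‖p.snd‖])

theorem norm_snd_le {α β : Type*} [SeminormedAddCommGroup α] [SeminormedAddCommGroup β]
    (p : WithLp 2 (α × β)) : ‖p.snd‖ ≤ ‖p‖ := by
  rw [WithLp.prod_norm_eq_of_L2]
  exact Real.le_sqrt_of_sq_le (by nlinarith [sq_nonneg ‖p.fst‖])

theorem isTest_segmentAverage {d : ℕ} (i : Fin d) {D : Set (E d)} {z : E d} {c₀ c ρ : ℝ}
    (hD : Metric.ball z c₀ ⊆ D) (hc : 0 < c) (hρ : ρ + c < c₀) {η : ℝ → ℝ} (hη : Continuous η)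
    {g : E d → ℝ} (hg : ContDiff ℝ ∞ g) (hg' : Function.support g ⊆ Metric.closedBall z ρ) :
    IsTest D (segmentAverage i c η g) := by
  have h1 : HasCompactSupport g :=
    HasCompactSupport.of_support_subset_isCompact (isCompact_closedBall z ρ) hg'
  have h2 := support_segmentAverage_subset i hc η hg'
  refine ⟨contDiff_segmentAverage i hc hη hg h1,
    HasCompactSupport.of_support_subset_isCompact (isCompact_closedBall z (ρ + c)) h2, ?_⟩
  exact (closure_minimal h2 Metric.isClosed_closedBall).trans
    ((Metric.closedBall_subset_ball hρ).trans hD)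

/-- With `g = ∂ᵢH + c⁻¹ A`, the weak gradient moves `∂ᵢ` from `H` to `p`; what remains are pairings
with `H` and `A`, which carry the small factor `√(2ρc)`. The room `ρ + c < c₀` keeps both inside
`D`, so that they are admissible test functions. -/
theorem norm_integral_mul_test_le {d : ℕ} (i : Fin d) {D : Set (E d)} {z : E d} {c₀ c ρ : ℝ}
    (hD : Metric.ball z c₀ ⊆ D) (hc : 0 < c) (hρ0 : 0 ≤ ρ) (hρ : ρ + c < c₀)
    {p : L2Pair D} (hp : p ∈ H1 D) {g : E d → ℝ} (hg : ContDiff ℝ ∞ g)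
    (hg' : Function.support g ⊆ Metric.closedBall z ρ) :
    ‖∫ x in D, p.fst x * (g x : ℂ)‖
      ≤ (1 + c⁻¹) * √(2 * ρ * c) * ‖p‖ * (eLpNorm g 2 volume).toReal := by
  have hcs : HasCompactSupport g :=
    HasCompactSupport.of_support_subset_isCompact (isCompact_closedBall z ρ) hg'
  have hgL : MemLp g 2 volume := hg.continuous.memLp_of_hasCompactSupport hcs
  set H := segmentAverage i c (fun s => 1 - s / c) g
  set A := segmentAverage i c (fun _ => 1) g
  have hH : IsTest D H := isTest_segmentAverage i hD hc hρ (by fun_prop) hg hg'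
  have hA : IsTest D A := isTest_segmentAverage i hD hc hρ (by fun_prop) hg hg'
  have bound : ∀ {f : E d → ℝ}, eLpNorm f 2 volume
      ≤ ENNReal.ofReal (√(2 * ρ * c)) * eLpNorm g 2 volume →
      (eLpNorm (fun x => (f x : ℂ)) 2 (vol D)).toReal
        ≤ √(2 * ρ * c) * (eLpNorm g 2 volume).toReal := by
    intro f hf
    have := ENNReal.toReal_mono (ENNReal.mul_ne_top ENNReal.ofReal_ne_top hgL.2.ne)
      ((eLpNorm_ofReal_restrict_le D f).trans hf)
    rwa [ENNReal.toReal_mul, ENNReal.toReal_ofReal (Real.sqrt_nonneg _)] at this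
  have hHn := bound (eLpNorm_segmentAverage_le i (η := fun s => 1 - s / c) hc
    (fun s hs => by
      have h1 : 0 ≤ s / c := div_nonneg hs.1.le hc.le
      have h2 : s / c ≤ 1 := (div_le_one hc).2 hs.2
      rw [abs_le]; constructor <;> linarith) hg.continuous hg' hρ0)
  have hAn := bound (eLpNorm_segmentAverage_le i (η := fun _ => 1) hc
    (fun s hs => by simp) hg.continuous hg' hρ0)
  have hsplit : ∫ x in D, p.fst x * (g x : ℂ)
      = (∫ x in D, p.fst x * (partialDeriv i H x : ℂ))
        + (c⁻¹ : ℂ) * ∫ x in D, p.fst x * (A x : ℂ) := by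
    rw [← integral_const_mul]
    refine Eq.trans ?_ (integral_add
      (MemLp.integrable_mul (Lp.memLp p.fst) (hH.memLp_partialDeriv i))
      ((MemLp.integrable_mul (Lp.memLp p.fst) hA.memLp).const_mul (c⁻¹ : ℂ)))
    refine integral_congr_ae (.of_forall fun x => ?_)
    simp only [H, A, partialDeriv_segmentAverage i hc hg hcs x]
    push_cast
    ring
  have hcoord : (eLpNorm (fun x => p.snd x i) 2 (vol D)).toReal ≤ ‖p‖ := by
    refine le_trans ?_ (norm_snd_le p)
    rw [Lp.norm_def]
    exact ENNReal.toReal_mono (Lp.memLp p.snd).2.ne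
      (eLpNorm_mono fun x => PiLp.norm_apply_le (p.snd x) i)
  have hfst : (eLpNorm p.fst 2 (vol D)).toReal ≤ ‖p‖ := by
    rw [← Lp.norm_def]; exact norm_fst_le p
  have e1 : ‖∫ x in D, p.fst x * (partialDeriv i H x : ℂ)‖
      ≤ ‖p‖ * (√(2 * ρ * c) * (eLpNorm g 2 volume).toReal) := by
    rw [hp H hH i, norm_neg]
    exact (norm_integral_mul_le_eLpNorm (memLp_coord p.snd i) hH.memLp).trans
      (mul_le_mul hcoord hHn ENNReal.toReal_nonneg (norm_nonneg _))
  have e2 : ‖∫ x in D, p.fst x * (A x : ℂ)‖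
      ≤ ‖p‖ * (√(2 * ρ * c) * (eLpNorm g 2 volume).toReal) :=
    (norm_integral_mul_le_eLpNorm (Lp.memLp p.fst) hA.memLp).trans
      (mul_le_mul hfst hAn ENNReal.toReal_nonneg (norm_nonneg _))
  rw [hsplit]
  refine (norm_add_le _ _).trans ?_
  rw [norm_mul]
  have e3 : ‖(c⁻¹ : ℂ)‖ = c⁻¹ := by
    rw [← Complex.ofReal_inv, Complex.norm_real, Real.norm_eq_abs, abs_of_pos (inv_pos.2 hc)]
  rw [e3]
  have e4 := mul_le_mul_of_nonneg_left e2 (inv_pos.2 hc).le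
  calc _ ≤ _ := add_le_add e1 e4
    _ = _ := by ring

/-- Weak gradients are tested with real functions, so real and imaginary parts are treated
separately, at the cost of a factor `2`. -/
theorem norm_integral_mul_complex_test_le {d : ℕ} (i : Fin d) {D : Set (E d)} {z : E d}
    {c₀ c ρ : ℝ} (hD : Metric.ball z c₀ ⊆ D) (hc : 0 < c) (hρ0 : 0 ≤ ρ) (hρ : ρ + c < c₀)
    {p : L2Pair D} (hp : p ∈ H1 D) {g : E d → ℂ} (hg : ContDiff ℝ ∞ g)
    (hg' : Function.support g ⊆ Metric.closedBall z ρ) :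
    ‖∫ x in D, p.fst x * g x‖
      ≤ 2 * ((1 + c⁻¹) * √(2 * ρ * c) * ‖p‖) * (eLpNorm g 2 volume).toReal := by
  have hcs : HasCompactSupport g :=
    HasCompactSupport.of_support_subset_isCompact (isCompact_closedBall z ρ) hg'
  have hgL : MemLp g 2 volume := hg.continuous.memLp_of_hasCompactSupport hcs
  set K := (1 + c⁻¹) * √(2 * ρ * c) * ‖p‖
  have hK : 0 ≤ K := by positivity
  have key : ∀ T : ℂ →L[ℝ] ℝ, (∀ w, ‖T w‖ ≤ ‖w‖) →
      Integrable (fun x => p.fst x * (T (g x) : ℂ)) (vol D) ∧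
      ‖∫ x in D, p.fst x * (T (g x) : ℂ)‖ ≤ K * (eLpNorm g 2 volume).toReal := by
    intro T hT
    have hs : Function.support (fun x => T (g x)) ⊆ Metric.closedBall z ρ := fun x hx =>
      hg' fun h => hx (by simp [h])
    have hsm : ContDiff ℝ ∞ fun x => T (g x) := T.contDiff.comp hg
    have hm : MemLp (fun x => (T (g x) : ℂ)) 2 (vol D) := by
      have h1 : Continuous fun x => (T (g x) : ℂ) :=
        Complex.continuous_ofReal.comp hsm.continuous
      refine (h1.memLp_of_hasCompactSupport (μ := volume) ?_).restrict D
      exact HasCompactSupport.of_support_subset_isCompact (isCompact_closedBall z ρ)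
        fun x hx => hs fun h => hx (by simp only at h; simp [h])
    refine ⟨MemLp.integrable_mul (Lp.memLp p.fst) hm, ?_⟩
    refine (norm_integral_mul_test_le i hD hc hρ0 hρ hp hsm hs).trans ?_
    refine mul_le_mul_of_nonneg_left (ENNReal.toReal_mono hgL.2.ne ?_) hK
    exact eLpNorm_mono fun x => hT _
  obtain ⟨i1, h1⟩ := key Complex.reCLM fun w => Complex.abs_re_le_norm w
  obtain ⟨i2, h2⟩ := key Complex.imCLM fun w => Complex.abs_im_le_norm w
  have : ∫ x in D, p.fst x * g x = (∫ x in D, p.fst x * (Complex.reCLM (g x) : ℂ))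
      + (∫ x in D, p.fst x * (Complex.imCLM (g x) : ℂ)) * Complex.I := by
    rw [← integral_mul_const, ← integral_add i1 (i2.mul_const _)]
    refine integral_congr_ae (.of_forall fun x => ?_)
    simp only [Complex.reCLM_apply, Complex.imCLM_apply]
    conv_lhs => rw [← Complex.re_add_im (g x)]
    ring
  rw [this]
  refine (norm_add_le _ _).trans ?_
  rw [norm_mul, Complex.norm_I, mul_one]
  linarith

/-! ### The `√r` estimate on small balls -/

/-- A function of `H¹(D)` has a small `L²` norm on small balls inside `D`. -/
theorem eLpNorm_ball_le {d : ℕ} (i : Fin d) {D : Set (E d)} {z : E d}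
    {c₀ c r : ℝ} (hD : Metric.ball z c₀ ⊆ D) (hc : 0 < c) (hr0 : 0 < r) (hr : 2 * r + c < c₀)
    {p : L2Pair D} (hp : p ∈ H1 D) :
    (eLpNorm p.fst 2 (volume.restrict (Metric.ball z r))).toReal
      ≤ 4 * (1 + c⁻¹) * √(r * c) * ‖p‖ := by
  set K := 4 * (1 + c⁻¹) * √(r * c) * ‖p‖
  have hK : 0 ≤ K := by positivity
  set N := (eLpNorm p.fst 2 (volume.restrict (Metric.ball z r))).toReal
  have hN0 : 0 ≤ N := ENNReal.toReal_nonneg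
  have hbD : Metric.ball z r ⊆ D := (Metric.ball_subset_ball (by linarith)).trans hD
  have hpm : MemLp p.fst 2 (volume.restrict (Metric.ball z r)) :=
    (Lp.memLp p.fst).mono_measure (Measure.restrict_mono hbD le_rfl)
  have hcm : MemLp (fun x => conj (p.fst x)) 2 (volume.restrict (Metric.ball z r)) := hpm.star
  -- The extremal test function: pairing it with `p.fst` gives `N ^ 2`, while its own norm is `N`.
  -- It is not smooth, so it is approximated up to `δ`.
  set f : E d → ℂ := (Metric.ball z r).indicator fun x => conj (p.fst x)
  have hf : MemLp f 2 volume := (memLp_indicator_iff_restrict measurableSet_ball).2 hcm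
  have hfN : (eLpNorm f 2 volume).toReal = N := by
    rw [eLpNorm_indicator_eq_eLpNorm_restrict measurableSet_ball]
    congr 1
    exact eLpNorm_congr_norm_ae (.of_forall fun x => by simp)
  have hint : ‖∫ x in D, p.fst x * f x‖ = N ^ 2 := by
    have h1 : (fun x => p.fst x * f x)
        = (Metric.ball z r).indicator fun x => p.fst x * conj (p.fst x) := by
      funext x
      by_cases hx : x ∈ Metric.ball z r <;> simp [f, hx]
    have h2 : inner ℂ hpm.toLp hpm.toLp
        = ∫ x in Metric.ball z r, p.fst x * conj (p.fst x) := by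
      rw [L2.inner_def]
      refine integral_congr_ae ?_
      filter_upwards [hpm.coeFn_toLp] with x hx
      rw [hx, RCLike.inner_apply]
    rw [h1, setIntegral_indicator measurableSet_ball, Set.inter_eq_right.2 hbD, ← h2,
      inner_self_eq_norm_sq_to_K, norm_pow, RCLike.norm_ofReal, abs_norm, Lp.norm_toLp]
  have main : ∀ δ : ℝ, 0 < δ → N ^ 2 ≤ K * N + (K + ‖p‖) * δ := by
    intro δ hδ
    obtain ⟨g, hg1, hg2, hg3⟩ := hf.exist_eLpNorm_sub_le (by norm_num) (by norm_num) hδ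
    -- The smooth approximation `g` need not be supported near the ball. Cutting off at radius `2r`
    -- does not increase the error, since `χ = 1` on the ball, `f = 0` off it, and `0 ≤ χ ≤ 1`.
    let χ : ContDiffBump z := ⟨r, 2 * r, hr0, by linarith⟩
    set h : E d → ℂ := fun x => χ x • g x
    have hhs : ContDiff ℝ ∞ h := χ.contDiff.smul hg2
    have hsupp : Function.support h ⊆ Metric.closedBall z (2 * r) := by
      intro x hx
      have : x ∈ Function.support χ := fun h0 => hx (by simp [h, h0])
      rw [χ.support_eq] at this
      exact Metric.ball_subset_closedBall this
    have hhm : MemLp h 2 volume := hhs.continuous.memLp_of_hasCompactSupport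
      (HasCompactSupport.of_support_subset_isCompact (isCompact_closedBall _ _) hsupp)
    have hdiff : eLpNorm (f - h) 2 volume ≤ ENNReal.ofReal δ := by
      refine le_trans (eLpNorm_mono fun x => ?_) hg3
      have : (f - h) x = χ x • (f - g) x := by
        by_cases hx : x ∈ Metric.ball z r
        · have : χ x = 1 := χ.one_of_mem_closedBall (Metric.ball_subset_closedBall hx)
          simp [h, this]
        · simp [h, f, hx]
      rw [this, norm_smul, Real.norm_eq_abs, abs_of_nonneg χ.nonneg]
      exact mul_le_of_le_one_left (norm_nonneg _) χ.le_one
    have hdiff' : (eLpNorm (f - h) 2 volume).toReal ≤ δ :=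
      ENNReal.toReal_le_of_le_ofReal hδ.le hdiff
    have hhN : (eLpNorm h 2 volume).toReal ≤ N + δ := by
      have : eLpNorm h 2 volume ≤ eLpNorm f 2 volume + eLpNorm (f - h) 2 volume := by
        have := eLpNorm_sub_le hf.1 (hf.sub hhm).1 (p := 2) (by norm_num)
        rwa [sub_sub_cancel] at this
      have := ENNReal.toReal_mono (ENNReal.add_ne_top.2 ⟨hf.2.ne, (hf.sub hhm).2.ne⟩) this
      rw [ENNReal.toReal_add hf.2.ne (hf.sub hhm).2.ne, hfN] at this
      linarith
    have e1 := norm_integral_mul_complex_test_le i hD hc (ρ := 2 * r) (by linarith) hr hp hhs hsupp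
    have hKeq : 2 * ((1 + c⁻¹) * √(2 * (2 * r) * c) * ‖p‖) = K := by
      have : √(2 * (2 * r) * c) = 2 * √(r * c) := by
        rw [show 2 * (2 * r) * c = 2 ^ 2 * (r * c) by ring, Real.sqrt_mul (by norm_num),
          Real.sqrt_sq (by norm_num)]
      rw [this]; simp only [K]; ring
    rw [hKeq] at e1
    have e2 := norm_integral_mul_le_eLpNorm (Lp.memLp p.fst) ((hf.sub hhm).restrict D)
    have e3 : (eLpNorm (f - h) 2 (vol D)).toReal ≤ δ :=
      (ENNReal.toReal_mono (hf.sub hhm).2.ne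
        (eLpNorm_mono_measure _ Measure.restrict_le_self)).trans hdiff'
    have e4 : ∫ x in D, p.fst x * f x
        = (∫ x in D, p.fst x * h x) + ∫ x in D, p.fst x * (f - h) x := by
      refine Eq.trans ?_ (integral_add (MemLp.integrable_mul (Lp.memLp p.fst) (hhm.restrict D))
        (MemLp.integrable_mul (Lp.memLp p.fst) ((hf.sub hhm).restrict D)))
      refine integral_congr_ae (.of_forall fun x => ?_)
      simp only [Pi.sub_apply]
      ring
    have e5 : ‖∫ x in D, p.fst x * (f - h) x‖ ≤ ‖p‖ * δ := by
      refine e2.trans (mul_le_mul ?_ e3 ENNReal.toReal_nonneg (norm_nonneg _))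
      rw [← Lp.norm_def]; exact norm_fst_le p
    rw [← hint, e4]
    refine (norm_add_le _ _).trans ?_
    have := mul_le_mul_of_nonneg_left hhN hK
    linarith
  -- Let `δ → 0`; the choice of `δ` makes the error term at most the given `ε`.
  have hlim : N ^ 2 ≤ K * N := by
    refine le_of_forall_pos_le_add fun ε hε => ?_
    have hp1 : 0 < K + ‖p‖ + 1 := by positivity
    refine (main (ε / (K + ‖p‖ + 1)) (by positivity)).trans ?_
    have : (K + ‖p‖) * (ε / (K + ‖p‖ + 1)) ≤ ε := by
      rw [mul_div_assoc', div_le_iff₀ hp1]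
      nlinarith
    linarith
  by_contra hlt
  push Not at hlt
  nlinarith

/-! ### Completeness of `X(D)` -/

theorem continuous_integral_mul_ofReal {α : Type*} [MeasurableSpace α] {μ : Measure α}
    {ψ : α → ℝ} (hψ : MemLp (fun x => (ψ x : ℂ)) 2 μ) :
    Continuous fun f : Lp ℂ 2 μ => ∫ x, f x * (ψ x : ℂ) ∂μ := by
  have : (fun f : Lp ℂ 2 μ => ∫ x, f x * (ψ x : ℂ) ∂μ) = fun f => inner ℂ hψ.toLp f := by
    funext f
    rw [L2.inner_def]
    refine integral_congr_ae ?_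
    filter_upwards [hψ.coeFn_toLp] with x hx
    rw [hx, RCLike.inner_apply, Complex.conj_ofReal]
  rw [this]
  fun_prop

/-- For each test function the defining identity equates two continuous functions of the pair.
Closedness makes `X D` complete, which the adjoints below require. -/
theorem isClosed_H1 {d : ℕ} (D : Set (E d)) : IsClosed (H1 D : Set (L2Pair D)) := by
  have : (H1 D : Set (L2Pair D)) = ⋂ (φ : E d → ℝ) (_ : IsTest D φ) (i : Fin d),
      {p | ∫ x in D, p.fst x * (partialDeriv i φ x : ℂ) = - ∫ x in D, p.snd x i * (φ x : ℂ)} := by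
    ext p
    simp only [Set.mem_iInter, Set.mem_ofPred_eq]
    rfl
  rw [this]
  refine isClosed_iInter fun φ => isClosed_iInter fun hφ => isClosed_iInter fun i =>
    isClosed_eq ?_ (Continuous.neg ?_)
  · exact (continuous_integral_mul_ofReal (hφ.memLp_partialDeriv i)).comp
      (WithLp.prod_continuous_ofLp 2 _ _).fst
  · have h := (continuous_integral_mul_ofReal hφ.memLp).comp
      (((EuclideanSpace.proj (𝕜 := ℂ) i).compLpL 2 (vol D)).continuous.comp
        (WithLp.prod_continuous_ofLp 2 (Lp ℂ 2 (vol D))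
          (Lp (EuclideanSpace ℂ (Fin d)) 2 (vol D))).snd)
    refine h.congr fun p => integral_congr_ae ?_
    filter_upwards [(EuclideanSpace.proj (𝕜 := ℂ) i).coeFn_compLpL (p := 2) p.snd] with x hx
    exact congrArg (· * (φ x : ℂ)) hx

theorem isClosed_X {d : ℕ} (D : Set (E d)) :
    IsClosed (X D : Set (WithLp 2 (L2Pair D × L2Pair D))) := by
  have h1 : Continuous fun p : WithLp 2 (L2Pair D × L2Pair D) => p.fst :=
    (WithLp.prod_continuous_ofLp 2 _ _).fst
  have h2 : Continuous fun p : WithLp 2 (L2Pair D × L2Pair D) => p.snd :=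
    (WithLp.prod_continuous_ofLp 2 _ _).snd
  exact ((isClosed_H1 D).preimage h1).inter (((isClosed_H1 D).preimage h2).inter
    ((Submodule.isClosed_topologicalClosure _).preimage (h1.sub h2)))

instance completeSpace_X {d : ℕ} (D : Set (E d)) : CompleteSpace (X D) :=
  (isClosed_X D).completeSpace_coe

/-! ### The operators representing the forms -/

/-- The embedding `(w, v) ↦ w` of `X(D)` in `L²(D)`. -/
noncomputable def wCLM {d : ℕ} (D : Set (E d)) : X D →L[ℂ] Lp ℂ 2 (vol D) :=
  LinearMap.mkContinuous
    { toFun := fun p => (p : WithLp 2 (L2Pair D × L2Pair D)).fst.fst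
      map_add' := fun _ _ => rfl
      map_smul' := fun _ _ => rfl } 1
    fun p => by
      rw [one_mul]
      exact (norm_fst_le _).trans (norm_fst_le _)

/-- The embedding `(w, v) ↦ v` of `X(D)` in `L²(D)`. -/
noncomputable def vCLM {d : ℕ} (D : Set (E d)) : X D →L[ℂ] Lp ℂ 2 (vol D) :=
  LinearMap.mkContinuous
    { toFun := fun p => (p : WithLp 2 (L2Pair D × L2Pair D)).snd.fst
      map_add' := fun _ _ => rfl
      map_smul' := fun _ _ => rfl } 1
    fun p => by
      rw [one_mul]
      exact (norm_fst_le _).trans (norm_snd_le _)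

theorem norm_wCLM_le {d : ℕ} (D : Set (E d)) : ‖wCLM D‖ ≤ 1 :=
  LinearMap.mkContinuous_norm_le _ zero_le_one _

/-- The coefficient `q` is measurable and bounded on `D`. -/
structure IsCoefficient {d : ℕ} (D : Set (E d)) (q : E d → ℝ) : Prop where
  aestronglyMeasurable : AEStronglyMeasurable q (vol D)
  bounded : ∃ K : ℝ, ∀ᵐ x ∂(vol D), |q x| ≤ K

theorem IsCoefficient.memLp_mul {d : ℕ} {D : Set (E d)} {q : E d → ℝ} (hq : IsCoefficient D q)
    {f : E d → ℂ} (hf : MemLp f 2 (vol D)) : MemLp (fun x => (q x : ℂ) * f x) 2 (vol D) := by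
  obtain ⟨K, hK⟩ := hq.bounded
  refine hf.of_le_mul (c := K)
    ((Complex.continuous_ofReal.comp_aestronglyMeasurable hq.aestronglyMeasurable).mul hf.1) ?_
  filter_upwards [hK] with x hx
  rw [norm_mul, Complex.norm_real]
  exact mul_le_mul_of_nonneg_right hx (norm_nonneg _)

/-- Multiplication by a coefficient, as an operator on `L²(D)`. -/
noncomputable def IsCoefficient.mulCLM {d : ℕ} {D : Set (E d)} {q : E d → ℝ}
    (hq : IsCoefficient D q) : Lp ℂ 2 (vol D) →L[ℂ] Lp ℂ 2 (vol D) :=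
  LinearMap.mkContinuous
    { toFun := fun f => (hq.memLp_mul (Lp.memLp f)).toLp
      map_add' := fun f g => by
        rw [← MemLp.toLp_add, MemLp.toLp_eq_toLp_iff]
        filter_upwards [Lp.coeFn_add f g] with x hx
        simp only [hx, Pi.add_apply, mul_add]
      map_smul' := fun c f => by
        rw [RingHom.id_apply, ← MemLp.toLp_const_smul, MemLp.toLp_eq_toLp_iff]
        filter_upwards [Lp.coeFn_smul c f] with x hx
        simp only [hx, Pi.smul_apply, smul_eq_mul]
        ring } |hq.bounded.choose|
    fun f => by
      refine Lp.norm_le_mul_norm_of_ae_le_mul ?_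
      filter_upwards [(hq.memLp_mul (Lp.memLp f)).coeFn_toLp, hq.bounded.choose_spec] with x hx hb
      simp only [LinearMap.coe_mk, AddHom.coe_mk]
      rw [hx, norm_mul, Complex.norm_real]
      exact mul_le_mul_of_nonneg_right (hb.trans (le_abs_self _)) (norm_nonneg _)

theorem IsCoefficient.coeFn_mulCLM {d : ℕ} {D : Set (E d)} {q : E d → ℝ}
    (hq : IsCoefficient D q) (f : Lp ℂ 2 (vol D)) :
    hq.mulCLM f =ᵐ[vol D] fun x => (q x : ℂ) * f x :=
  (hq.memLp_mul (Lp.memLp f)).coeFn_toLp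

/-- The operator `w† T w - v† v`. -/
noncomputable def pullbackOperator {W α : Type*} [NormedAddCommGroup W] [InnerProductSpace ℂ W]
    [MeasurableSpace α] {μ : Measure α} {P : Submodule ℂ W} [CompleteSpace P]
    (w v : P →L[ℂ] Lp ℂ 2 μ) (T : Lp ℂ 2 μ →L[ℂ] Lp ℂ 2 μ) : P →L[ℂ] P :=
  ContinuousLinearMap.adjoint (𝕜 := ℂ) (E := P) (F := Lp ℂ 2 μ) w ∘L T ∘L w -
    ContinuousLinearMap.adjoint (𝕜 := ℂ) (E := P) (F := Lp ℂ 2 μ) v ∘L v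

theorem inner_pullbackOperator {W α : Type*} [NormedAddCommGroup W] [InnerProductSpace ℂ W]
    [MeasurableSpace α] {μ : Measure α} {P : Submodule ℂ W} [CompleteSpace P]
    (w v : P →L[ℂ] Lp ℂ 2 μ) (T : Lp ℂ 2 μ →L[ℂ] Lp ℂ 2 μ) (p φ : P) :
    inner ℂ φ (pullbackOperator w v T p)
      = (∫ x, T (w p) x * conj (w φ x) ∂μ) - ∫ x, v p x * conj (v φ x) ∂μ := by
  have h1 : inner ℂ φ (pullbackOperator w v T p)
      = inner ℂ (w φ) (T (w p)) - inner ℂ (v φ) (v p) := by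
    simp [pullbackOperator, ContinuousLinearMap.adjoint_inner_right]
  rw [h1, L2.inner_def, L2.inner_def]
  simp only [RCLike.inner_apply]

/-- The `v` terms cancel and `‖w†‖ = ‖w‖ ≤ 1`. The hypothesis concerns `T - T'` only on the range of
`w`, measured by the norm of `p`: multiplication by `n_ε - n` need not be small as an operator on
`L²`, only on `H¹` functions. -/
theorem norm_pullbackOperator_sub_le {W α : Type*} [NormedAddCommGroup W] [InnerProductSpace ℂ W]
    [MeasurableSpace α] {μ : Measure α} {P : Submodule ℂ W} [CompleteSpace P]
    (w v : P →L[ℂ] Lp ℂ 2 μ) (T T' : Lp ℂ 2 μ →L[ℂ] Lp ℂ 2 μ) (hw : ‖w‖ ≤ 1) {C : ℝ} (hC : 0 ≤ C)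
    (h : ∀ p, ‖T (w p) - T' (w p)‖ ≤ C * ‖p‖) :
    ‖pullbackOperator w v T - pullbackOperator w v T'‖ ≤ C := by
  refine ContinuousLinearMap.opNorm_le_bound _ hC fun p => ?_
  have h1 : (pullbackOperator w v T - pullbackOperator w v T') p
      = ContinuousLinearMap.adjoint (𝕜 := ℂ) (E := P) (F := Lp ℂ 2 μ) w
        (T (w p) - T' (w p)) := by
    simp [pullbackOperator]
  rw [h1]
  refine (ContinuousLinearMap.le_opNorm _ _).trans (le_trans ?_ (h p))
  rw [LinearIsometryEquiv.norm_map]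
  exact mul_le_of_le_one_left (norm_nonneg _) hw

/-- The operator on `X(D)` that represents the form with coefficient `q`. -/
noncomputable def IsCoefficient.operator {d : ℕ} {D : Set (E d)} {q : E d → ℝ}
    (hq : IsCoefficient D q) : X D →L[ℂ] X D :=
  pullbackOperator (wCLM D) (vCLM D) hq.mulCLM

theorem integrable_mul_conj {α : Type*} [MeasurableSpace α] {μ : Measure α} (f g : Lp ℂ 2 μ) :
    Integrable (fun x => f x * conj (g x)) μ :=
  MemLp.integrable_mul (Lp.memLp f) (Lp.memLp g).star

theorem IsCoefficient.isOperatorOf {d : ℕ} {D : Set (E d)} {q : E d → ℝ}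
    (hq : IsCoefficient D q) : IsOperatorOf D q hq.operator := by
  intro p φ
  refine (inner_pullbackOperator (wCLM D) (vCLM D) hq.mulCLM p φ).trans ?_
  rw [← integral_sub (integrable_mul_conj _ _) (integrable_mul_conj _ _), formB]
  refine integral_congr_ae ?_
  filter_upwards [hq.coeFn_mulCLM (wCLM D p)] with x hx
  rw [hx]
  rfl

theorem norm_operator_sub_le {d : ℕ} {D : Set (E d)} {q q' : E d → ℝ}
    (hq : IsCoefficient D q) (hq' : IsCoefficient D q') {C : ℝ} (hC : 0 ≤ C)
    (h : ∀ p : X D, ‖hq.mulCLM (wCLM D p) - hq'.mulCLM (wCLM D p)‖ ≤ C * ‖p‖) :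
    ‖hq.operator - hq'.operator‖ ≤ C :=
  norm_pullbackOperator_sub_le (wCLM D) (vCLM D) _ _ (norm_wCLM_le D) hC h

/-! ### Defects and the perturbed coefficient -/

/-- A ball that misses the frontier is covered by the disjoint open sets `D` and `(closure D)ᶜ`;
being connected and meeting `D`, it lies in `D`. -/
theorem ball_subset_of_le_infDist_frontier {d : ℕ} {D : Set (E d)} (hD : IsOpen D) {z : E d}
    (hz : z ∈ D) {c : ℝ} (hc : 0 < c) (h : c ≤ Metric.infDist z (frontier D)) :
    Metric.ball z c ⊆ D := by
  have hdisj : ∀ x ∈ Metric.ball z c, x ∉ frontier D := fun x hx hx' => by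
    have := Metric.infDist_le_dist_of_mem (x := z) hx'
    rw [Metric.mem_ball, dist_comm] at hx
    linarith
  refine (convex_ball z c).isPreconnected.subset_left_of_subset_union hD
    isClosed_closure.isOpen_compl (v := (closure D)ᶜ)
    (Set.disjoint_compl_right_iff_subset.2 subset_closure) (fun x hx => ?_)
    ⟨z, Metric.mem_ball_self hc, hz⟩
  by_cases hx' : x ∈ closure D
  · left
    by_contra h
    exact hdisj x hx ⟨hx', by rwa [hD.interior_eq]⟩
  · exact Or.inr hx'

theorem defect_subset_ball {d M : ℕ} {z : Fin M → E d} {S : Fin M → Set (E d)} {R ε : ℝ}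
    {m : Fin M} (hS : S m ⊆ Metric.ball 0 R) (hε : 0 < ε) :
    defect z S ε m ⊆ Metric.ball (z m) (ε * R) := by
  rintro _ ⟨y, hy, rfl⟩
  have := hS hy
  rw [mem_ball_zero_iff] at this
  rw [Metric.mem_ball, dist_eq_norm, add_sub_cancel_left, norm_smul, Real.norm_eq_abs,
    abs_of_pos hε]
  exact mul_lt_mul_of_pos_left this hε

theorem isOpen_defect {d M : ℕ} {z : Fin M → E d} {S : Fin M → Set (E d)} {ε : ℝ}
    {m : Fin M} (hS : IsOpen (S m)) (hε : 0 < ε) : IsOpen (defect z S ε m) := by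
  have h : defect z S ε m = (Homeomorph.addLeft (z m)) ''
      ((Homeomorph.smulOfNeZero ε hε.ne') '' S m) := by
    rw [Set.image_image]
    rfl
  rw [h]
  exact (Homeomorph.isOpenMap _) _ ((Homeomorph.isOpenMap _) _ hS)

theorem perturbed_of_mem {d M : ℕ} {n : E d → ℝ} {z : Fin M → E d} {S : Fin M → Set (E d)}
    {nm : Fin M → ℝ} {ε : ℝ} (h : Admissible z S ε) {m : Fin M} {x : E d}
    (hx : x ∈ defect z S ε m) : perturbed n z S nm ε x = nm m := by
  have hex : ∃ m, x ∈ defect z S ε m := ⟨m, hx⟩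
  rw [perturbed, dif_pos hex]
  congr 1
  by_contra hne
  exact Set.disjoint_left.1 (h.2 hne) hex.choose_spec hx

theorem perturbed_of_notMem {d M : ℕ} {n : E d → ℝ} {z : Fin M → E d} {S : Fin M → Set (E d)}
    {nm : Fin M → ℝ} {ε : ℝ} {x : E d} (hx : ∀ m, x ∉ defect z S ε m) :
    perturbed n z S nm ε x = n x :=
  dif_neg fun ⟨m, hm⟩ => hx m hm

/-- The bound is a sum of indicators, so it survives the later passage from the defects to enclosing
balls, which may overlap even when the defects do not. -/
theorem abs_perturbed_sub_le {d M : ℕ} {n : E d → ℝ} {z : Fin M → E d} {S : Fin M → Set (E d)}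
    {nm : Fin M → ℝ} {ε K : ℝ} (h : Admissible z S ε) {x : E d} (hK : |n x| ≤ K) :
    |perturbed n z S nm ε x - n x|
      ≤ ∑ m, (defect z S ε m).indicator (fun _ => (∑ j, |nm j|) + K) x := by
  have hpos : 0 ≤ (∑ j, |nm j|) + K :=
    add_nonneg (Finset.sum_nonneg fun _ _ => abs_nonneg _) ((abs_nonneg _).trans hK)
  by_cases hx : ∃ m, x ∈ defect z S ε m
  · obtain ⟨m, hm⟩ := hx
    rw [perturbed_of_mem h hm]
    calc |nm m - n x| ≤ |nm m| + |n x| := abs_sub _ _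
      _ ≤ (∑ j, |nm j|) + K := add_le_add
        (Finset.single_le_sum (f := fun j => |nm j|) (fun _ _ => abs_nonneg _)
          (Finset.mem_univ m)) hK
      _ = (defect z S ε m).indicator (fun _ => (∑ j, |nm j|) + K) x := by
        rw [Set.indicator_of_mem hm]
      _ ≤ _ := Finset.single_le_sum
        (f := fun m => (defect z S ε m).indicator (fun _ => (∑ j, |nm j|) + K) x)
        (fun _ _ => Set.indicator_nonneg (fun _ _ => hpos) _) (Finset.mem_univ m)
  · push Not at hx
    rw [perturbed_of_notMem hx, sub_self, abs_zero]
    exact Finset.sum_nonneg fun _ _ => Set.indicator_nonneg (fun _ _ => hpos) _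

theorem isCoefficient_of_continuousOn {d : ℕ} {D : Set (E d)} (hD : IsOpen D) {n : E d → ℝ}
    (hn : ContinuousOn n D) {K : ℝ} (hK : ∀ x ∈ D, |n x| ≤ K) : IsCoefficient D n :=
  ⟨hn.aestronglyMeasurable hD.measurableSet, K, ae_restrict_of_forall_mem hD.measurableSet hK⟩

theorem isCoefficient_perturbed {d M : ℕ} {D : Set (E d)} {n : E d → ℝ} (hn : IsCoefficient D n)
    {z : Fin M → E d} {S : Fin M → Set (E d)} (hS : ∀ m, IsOpen (S m)) (nm : Fin M → ℝ) {ε : ℝ}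
    (h : Admissible z S ε) : IsCoefficient D (perturbed n z S nm ε) := by
  have hm : ∀ m, MeasurableSet (defect z S ε m) := fun m => (isOpen_defect (hS m) h.1).measurableSet
  -- Disjointness turns the choice of index into a finite sum of indicators, from which
  -- measurability is visible.
  have heq : perturbed n z S nm ε = fun x =>
      n x + ∑ m, (defect z S ε m).indicator (fun x => nm m - n x) x := by
    funext x
    by_cases hx : ∃ m, x ∈ defect z S ε m
    · obtain ⟨m, hm⟩ := hx
      rw [perturbed_of_mem h hm, Finset.sum_eq_single m, Set.indicator_of_mem hm]
      · ring
      · intro j _ hj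
        exact Set.indicator_of_notMem (Set.disjoint_right.1 (h.2 hj) hm) _
      · simp
    · push Not at hx
      rw [perturbed_of_notMem hx, Finset.sum_eq_zero fun m _ => Set.indicator_of_notMem (hx m) _,
        add_zero]
  refine ⟨?_, ?_⟩
  · rw [heq]
    exact hn.1.add (Finset.aestronglyMeasurable_fun_sum _ fun m _ =>
      (aestronglyMeasurable_const.sub hn.1).indicator (hm m))
  · obtain ⟨K, hK⟩ := hn.bounded
    refine ⟨(∑ _m : Fin M, ((∑ j, |nm j|) + K)) + K, ?_⟩
    filter_upwards [hK] with x hx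
    have h1 := abs_perturbed_sub_le (nm := nm) h hx
    have hpos : 0 ≤ (∑ j, |nm j|) + K :=
      add_nonneg (Finset.sum_nonneg fun _ _ => abs_nonneg _) ((abs_nonneg _).trans hx)
    have h2 : ∑ m, (defect z S ε m).indicator (fun _ => (∑ j, |nm j|) + K) x
        ≤ ∑ _m : Fin M, ((∑ j, |nm j|) + K) :=
      Finset.sum_le_sum fun m _ => Set.indicator_le_self' (fun _ _ => hpos) x
    have h3 := abs_sub_abs_le_abs_sub (perturbed n z S nm ε x) (n x)
    linarith

/-! ### The rate `√ε` -/

/-- One constant serves every `r > 0`, because the rate is claimed for all admissible `ε` and not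
only small ones. For `r < c₀/8` take `c = c₀/2`, so that `2r + c < c₀`; for larger `r` the full norm
suffices, as `√r / √(c₀/8) ≥ 1`. -/
theorem exists_eLpNorm_ball_le {d : ℕ} (i : Fin d) (D : Set (E d)) {c₀ : ℝ} (hc₀ : 0 < c₀) :
    ∃ C : ℝ, 0 ≤ C ∧ ∀ z : E d, Metric.ball z c₀ ⊆ D → ∀ r : ℝ, 0 < r → ∀ p ∈ H1 D,
      (eLpNorm p.fst 2 ((vol D).restrict (Metric.ball z r))).toReal ≤ C * √r * ‖p‖ := by
  refine ⟨4 * (1 + (c₀ / 2)⁻¹) * √(c₀ / 2) + (√(c₀ / 8))⁻¹, by positivity, ?_⟩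
  intro z hz r hr p hp
  rcases lt_or_ge r (c₀ / 8) with h | h
  · have hbD : Metric.ball z r ⊆ D := (Metric.ball_subset_ball (by linarith)).trans hz
    have h1 := eLpNorm_ball_le i hz (c := c₀ / 2) (by linarith) hr (by linarith) hp
    rw [Measure.restrict_restrict measurableSet_ball, Set.inter_eq_left.2 hbD]
    refine h1.trans ?_
    rw [Real.sqrt_mul hr.le]
    have : 0 ≤ (√(c₀ / 8))⁻¹ * √r * ‖p‖ := by positivity
    linarith
  · have h1 : (eLpNorm p.fst 2 ((vol D).restrict (Metric.ball z r))).toReal ≤ ‖p‖ := by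
      refine le_trans ?_ (norm_fst_le p)
      rw [Lp.norm_def]
      exact ENNReal.toReal_mono (Lp.memLp p.fst).2.ne
        (eLpNorm_mono_measure _ Measure.restrict_le_self)
    have h2 : 1 ≤ (√(c₀ / 8))⁻¹ * √r := by
      rw [inv_mul_eq_div, one_le_div (Real.sqrt_pos.2 (by linarith))]
      exact Real.sqrt_le_sqrt h
    have h3 : 0 ≤ 4 * (1 + (c₀ / 2)⁻¹) * √(c₀ / 2) * √r := by positivity
    nlinarith [norm_nonneg p]

theorem norm_mulCLM_sub_le {d M : ℕ} {D : Set (E d)} {n q : E d → ℝ}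
    (hn : IsCoefficient D n) (hq : IsCoefficient D q) {A : Fin M → Set (E d)}
    (hA : ∀ m, MeasurableSet (A m)) {K : ℝ} (hK : 0 ≤ K)
    (h : ∀ᵐ x ∂(vol D), |q x - n x| ≤ ∑ m, (A m).indicator (fun _ => K) x) (f : Lp ℂ 2 (vol D)) :
    ‖hq.mulCLM f - hn.mulCLM f‖
      ≤ K * ∑ m, (eLpNorm f 2 ((vol D).restrict (A m))).toReal := by
  have hfin : ∀ m, eLpNorm f 2 ((vol D).restrict (A m)) ≠ ⊤ := fun m =>
    ((Lp.memLp f).restrict (A m)).2.ne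
  have h1 : eLpNorm (hq.mulCLM f - hn.mulCLM f : Lp ℂ 2 (vol D)) 2 (vol D)
      ≤ ENNReal.ofReal K * ∑ m, eLpNorm f 2 ((vol D).restrict (A m)) := by
    calc eLpNorm (hq.mulCLM f - hn.mulCLM f : Lp ℂ 2 (vol D)) 2 (vol D)
        ≤ ENNReal.ofReal K *
          eLpNorm (∑ m, (A m).indicator fun x => ‖f x‖) 2 (vol D) := by
          refine eLpNorm_le_mul_eLpNorm_of_ae_le_mul ?_ 2
          filter_upwards [h, Lp.coeFn_sub (hq.mulCLM f) (hn.mulCLM f), hq.coeFn_mulCLM f,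
            hn.coeFn_mulCLM f] with x hx h1 h2 h3
          rw [h1, Pi.sub_apply, h2, h3, ← sub_mul, norm_mul, ← Complex.ofReal_sub,
            Complex.norm_real, Real.norm_eq_abs, Finset.sum_apply, Real.norm_eq_abs]
          refine le_trans ?_ (mul_le_mul_of_nonneg_left (le_abs_self _) hK)
          refine (mul_le_mul_of_nonneg_right hx (norm_nonneg _)).trans_eq ?_
          rw [Finset.sum_mul, Finset.mul_sum]
          refine Finset.sum_congr rfl fun m _ => ?_
          by_cases hm : x ∈ A m <;> simp [hm]
      _ ≤ ENNReal.ofReal K * ∑ m, eLpNorm ((A m).indicator fun x => ‖f x‖) 2 (vol D) := by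
          gcongr
          exact eLpNorm_sum_le (fun m _ => (Lp.aestronglyMeasurable f).norm.indicator (hA m))
            (by norm_num)
      _ = _ := by
          congr 1
          refine Finset.sum_congr rfl fun m _ => ?_
          rw [eLpNorm_indicator_eq_eLpNorm_restrict (hA m), eLpNorm_norm]
  rw [Lp.norm_def]
  refine (ENNReal.toReal_mono (ENNReal.mul_ne_top ENNReal.ofReal_ne_top
    (ENNReal.sum_ne_top.2 fun m _ => hfin m)) h1).trans_eq ?_
  rw [ENNReal.toReal_mul, ENNReal.toReal_ofReal hK, ENNReal.toReal_sum fun m _ => hfin m]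

/-- The operators of the perturbed coefficients converge at the rate `√ε`. -/
theorem exists_norm_operator_perturbed_sub_le {d M : ℕ} (i : Fin d) {D : Set (E d)}
    (hD : IsOpen D) {n : E d → ℝ} (hn : IsCoefficient D n) {K : ℝ} (hK : ∀ x ∈ D, |n x| ≤ K)
    (hK0 : 0 ≤ K) {z : Fin M → E d} {S : Fin M → Set (E d)} (hS : ∀ m, IsOpen (S m))
    (nm : Fin M → ℝ) {c₀ R : ℝ} (hc₀ : 0 < c₀) (hz : ∀ m, Metric.ball (z m) c₀ ⊆ D) (hR : 0 < R)
    (hSR : ∀ m, S m ⊆ Metric.ball 0 R) :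
    ∃ C : ℝ, 0 ≤ C ∧ ∀ ε, ∀ h : Admissible z S ε,
      ‖(isCoefficient_perturbed hn hS nm h).operator - hn.operator‖ ≤ C * √ε := by
  obtain ⟨C, hC, hloc⟩ := exists_eLpNorm_ball_le i D hc₀
  set K' := (∑ j, |nm j|) + K
  have hK' : 0 ≤ K' := add_nonneg (Finset.sum_nonneg fun _ _ => abs_nonneg _) hK0
  -- `K'` bounds the jump of the coefficient, `M` counts the balls, and `√(ε R) = √ε √R`.
  refine ⟨K' * (M * (C * √R)), by positivity, fun ε h => ?_⟩
  refine norm_operator_sub_le _ _ (by positivity) fun p => ?_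
  have h1 := norm_mulCLM_sub_le hn (isCoefficient_perturbed hn hS nm h)
    (A := fun m => Metric.ball (z m) (ε * R)) (fun m => measurableSet_ball) hK'
    (ae_restrict_of_forall_mem hD.measurableSet fun x hx =>
      (abs_perturbed_sub_le h (hK x hx)).trans (Finset.sum_le_sum fun m _ =>
        Set.indicator_le_indicator_of_subset (defect_subset_ball (hSR m) h.1)
          (fun _ => hK') x)) (wCLM D p)
  have h2 : ∑ m, (eLpNorm (wCLM D p) 2
      ((vol D).restrict (Metric.ball (z m) (ε * R)))).toReal
      ≤ ∑ _m : Fin M, C * √(ε * R) * ‖p‖ := by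
    refine Finset.sum_le_sum fun m _ => ?_
    refine (hloc (z m) (hz m) (ε * R) (mul_pos h.1 hR) _ p.2.1).trans ?_
    exact mul_le_mul_of_nonneg_left (norm_fst_le _) (by positivity)
  refine h1.trans ((mul_le_mul_of_nonneg_left h2 hK').trans_eq ?_)
  rw [Finset.sum_const, Finset.card_univ, Fintype.card_fin, nsmul_eq_mul, Real.sqrt_mul h.1.le]
  ring

theorem tendsto_of_opNorm_sub_le {ι W : Type*} [NormedAddCommGroup W] [InnerProductSpace ℂ W]
    {P : Submodule ℂ W} {l : Filter ι} {f : ι → P →L[ℂ] P} {a : P →L[ℂ] P} {b : ι → ℝ}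
    (h : ∀ᶠ t in l, ‖f t - a‖ ≤ b t) (hb : Tendsto b l (𝓝 0)) : Tendsto f l (𝓝 a) := by
  refine (tendsto_iff_norm_sub_tendsto_zero (E := P →L[ℂ] P)).2 ?_
  exact squeeze_zero' (.of_forall fun t => norm_nonneg (E := P →L[ℂ] P) (f t - a)) h hb

theorem eventually_admissible {d M : ℕ} {D : Set (E d)} {z : Fin M → E d} {S : Fin M → Set (E d)}
    {c₀ R : ℝ} (hc₀ : 0 < c₀) (hsep : ∀ i j, i ≠ j → c₀ ≤ dist (z i) (z j))
    (hz : ∀ m, Metric.ball (z m) c₀ ⊆ D) (hR : 0 < R) (hSR : ∀ m, S m ⊆ Metric.ball 0 R) :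
    ∀ᶠ ε in 𝓝[>] (0 : ℝ), Admissible z S ε ∧ ∀ m, defect z S ε m ⊆ D := by
  have h0 : (0 : ℝ) < c₀ / (2 * R) := by positivity
  -- For `ε < c₀/(2R)` the enclosing balls have radius at most `c₀/2`: they are disjoint by the
  -- separation of the centers and lie in `D`.
  filter_upwards [Ioo_mem_nhdsGT h0] with ε hε
  have h1 : ε * R ≤ c₀ / 2 := by
    have := (lt_div_iff₀ (by positivity)).1 hε.2
    linarith
  refine ⟨⟨hε.1, fun i j hij => ?_⟩, fun m => ?_⟩
  · refine Disjoint.mono (defect_subset_ball (hSR i) hε.1) (defect_subset_ball (hSR j) hε.1) ?_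
    exact Metric.ball_disjoint_ball (by linarith [hsep i j hij])
  · exact (defect_subset_ball (hSR m) hε.1).trans
      ((Metric.ball_subset_ball (by linarith)).trans (hz m))

end Transmission

/-! ### Assembly of the theorem -/

open Transmission in
theorem mainTheorem5 (d : ℕ) (hd : d = 2 ∨ d = 3) :
    ∃ α ∈ Set.Ioo (0 : ℝ) 1,
      ∀ (D : Set (E d)), IsOpen D → IsConnected D → Bornology.IsBounded D →
      ∀ (n : E d → ℝ), ContDiffOn ℝ 1 n D → (∃ K : ℝ, ∀ x ∈ D, |n x| ≤ K) →
      ∀ (M : ℕ) (z : Fin M → E d) (S : Fin M → Set (E d)) (nm : Fin M → ℝ) (c₀ : ℝ), 0 < c₀ →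
      (∀ i j, i ≠ j → c₀ ≤ dist (z i) (z j)) →
      (∀ m, z m ∈ D ∧ c₀ ≤ Metric.infDist (z m) (frontier D)) →
      (∀ m, IsOpen (S m) ∧ Bornology.IsBounded (S m)) →
      (∀ᶠ ε in 𝓝[>] (0 : ℝ), Admissible z S ε ∧ ∀ m, defect z S ε m ⊆ D) ∧
      ∃ (B₀ : X D →L[ℂ] X D) (B : ℝ → (X D →L[ℂ] X D)),
        IsOperatorOf D n B₀ ∧
        (∀ ε, Admissible z S ε → IsOperatorOf D (perturbed n z S nm ε) (B ε)) ∧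
        Tendsto B (𝓝[>] 0) (𝓝 B₀) ∧
        ∃ C : ℝ, ∀ ε, Admissible z S ε → ‖B ε - B₀‖ ≤ C * ε ^ α := by
  classical
  have hd0 : 0 < d := by rcases hd with rfl | rfl <;> norm_num
  refine ⟨1 / 2, ⟨by norm_num, by norm_num⟩, ?_⟩
  intro D hD hDc _ n hn ⟨K, hK⟩ M z S nm c₀ hc₀ hsep hz hS
  have hball : ∀ m, Metric.ball (z m) c₀ ⊆ D := fun m =>
    ball_subset_of_le_infDist_frontier hD (hz m).1 hc₀ (hz m).2
  obtain ⟨R, hR, hSR⟩ : ∃ R : ℝ, 0 < R ∧ ∀ m, S m ⊆ Metric.ball 0 R := by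
    have hb : Bornology.IsBounded (⋃ m, S m) :=
      Bornology.isBounded_iUnion.2 fun m => (hS m).2
    obtain ⟨R, hR, h⟩ := hb.subset_ball_lt 0 0
    exact ⟨R, hR, fun m => (Set.subset_iUnion S m).trans h⟩
  have hK0 : 0 ≤ K := by
    obtain ⟨x, hx⟩ := hDc.nonempty
    exact (abs_nonneg _).trans (hK x hx)
  have hcoef := isCoefficient_of_continuousOn hD hn.continuousOn hK
  have hadm := eventually_admissible (D := D) hc₀ hsep hball hR hSR
  -- A single coordinate direction is enough, so index `0` is taken.
  obtain ⟨C, hC, hrate⟩ := exists_norm_operator_perturbed_sub_le ⟨0, hd0⟩ hD hcoef hK hK0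
    (fun m => (hS m).1) nm hc₀ hball hR hSR
  -- For inadmissible `ε` the unperturbed operator is a default value; the limit ignores it, because
  -- all small `ε > 0` are admissible.
  let B : ℝ → (X D →L[ℂ] X D) := fun ε =>
    if h : Admissible z S ε then (isCoefficient_perturbed hcoef (fun m => (hS m).1) nm h).operator
    else hcoef.operator
  have hB : ∀ ε, ∀ h : Admissible z S ε,
      B ε = (isCoefficient_perturbed hcoef (fun m => (hS m).1) nm h).operator :=
    fun ε h => dif_pos h
  refine ⟨hadm, hcoef.operator, B, hcoef.isOperatorOf, fun ε h => ?_, ?_, C, fun ε h => ?_⟩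
  · rw [hB ε h]
    exact IsCoefficient.isOperatorOf _
  · have hlim : Tendsto (fun ε : ℝ => C * √ε) (𝓝[>] 0) (𝓝 0) := by
      have : Tendsto (fun ε : ℝ => C * √ε) (𝓝 0) (𝓝 (C * √0)) :=
        (continuous_const.mul Real.continuous_sqrt).tendsto 0
      rw [Real.sqrt_zero, mul_zero] at this
      exact this.mono_left nhdsWithin_le_nhds
    refine tendsto_of_opNorm_sub_le ?_ hlim
    filter_upwards [hadm] with ε hε
    rw [hB ε hε.1]
    exact hrate ε hε.1
  · rw [hB ε h, ← Real.sqrt_eq_rpow]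
    exact hrate ε h
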